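/- A differential space is a pair $(M,\mathscr F)$ of a topological space $M$ and a nonempty set $\mathscr F$ of functions $M\to\mathbb R$ such that: the topology of $M$ is the smallest one making all $f\in\mathscr F$ continuous; $g\circ(f_1,\dots,f_m)\in\mathscr F$ for all $m\ge 0$, $g\in C^\infty(\mathbb R^m)$ and $f_1,\dots,f_m\in\mathscr F$; and any function $M\to\mathbb R$ that agrees near each point with some element of $\mathscr F$ is in $\mathscr F$. A map $\varphi\colon(M,\mathscr F)\to(N,\mathscr G)$ is smooth if $f\circ\varphi\in\mathscr F$ for all $f\in\mathscr G$. A subset of a differential space carries the subspace structure, i.e. the smallest differential structure containing the restrictions of the given functions. An embedding is an injective smooth map that is a diffeomorphism (smooth with smooth inverse) onto its image with the subspace structure. The space $(M,\mathscr F)$ is subcartesian if every $p\in M$ has an open neighbourhood, with the subspace structure, that embeds in some $(\mathbb R^n,C^\infty(\mathbb R^n))$; the least such $n$ is the structural dimension at $p$, and the structural dimension of $M$ is the supremum of these over $p\in M$. A derivation of $\mathscr F$ is an $\mathbb R$-linear map $v\colon\mathscr F\to\mathscr F$ with $v(fg)=v(f)g+fv(g)$. An integral curve of $v$ is a map $\gamma\colon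 J\to M$, where $J\subseteq\mathbb R$ is a connected set containing $0$, such that either $J=\{0\}$, or $\gamma$ is smooth (with $J$ carrying the subspace structure from $\mathbb R$) and $\frac{d}{dx}(f\circ\gamma)=v(f)\circ\gamma$ on $J$ for all $f\in\mathscr F$. It is maximal if for every integral curve $\tau\colon K\to M$ of $v$ with $\tau(0)=\gamma(0)$ we have $K\subseteq J$ and $\gamma|_K=\tau$. **Corollary.** Let $(M,\mathscr F)$ be a second countable subcartesian differential space of finite structural dimension. Then for every derivation $v\colon\mathscr F\to\mathscr F$ and every point $p\in M$ there is a unique maximal integral curve $\gamma_p$ of $v$ with $\gamma_p(0)=p$. -/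

import Mathlib

open scoped ContDiff

namespace DiffSpace

/-- The smallest topology on `M` making every function in `F` continuous. -/
@[reducible]
def initialTopology {M : Type*} (F : Set (M → ℝ)) : TopologicalSpace M :=
  ⨅ f ∈ F, TopologicalSpace.induced f inferInstance

/-- `F` is a differential structure (in the sense of Sikorski) on the topological space `M`,
i.e. `(M, F)` is a differential space. -/
structure IsDifferentialStructure {M : Type*} [t : TopologicalSpace M] (F : Set (M → ℝ)) :
    Prop where
  nonempty : F.Nonempty
  topology_eq : t = initialTopology F
  comp_mem : ∀ (m : ℕ) (g : (Fin m → ℝ) → ℝ), ContDiff ℝ ∞ g →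
    ∀ f : Fin m → M → ℝ, (∀ i, f i ∈ F) → (fun x => g (fun i => f i x)) ∈ F
  mem_of_locally : ∀ g : M → ℝ,
    (∀ p : M, ∃ U ∈ nhds p, ∃ a ∈ F, Set.EqOn g a U) → g ∈ F

/-- A differential structure, as an algebra of functions under pointwise operations. -/
def IsDifferentialStructure.subalgebra {M : Type*} [TopologicalSpace M] {F : Set (M → ℝ)}
    (hF : IsDifferentialStructure F) : Subalgebra ℝ (M → ℝ) where
  carrier := F
  mul_mem' := by
    intro a b ha hb
    have h := hF.comp_mem 2 (fun y => y 0 * y 1) (by fun_prop) ![a, b]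
      (by intro i; fin_cases i <;> assumption)
    exact h
  add_mem' := by
    intro a b ha hb
    have h := hF.comp_mem 2 (fun y => y 0 + y 1) (by fun_prop) ![a, b]
      (by intro i; fin_cases i <;> assumption)
    exact h
  algebraMap_mem' := by
    intro r
    have h := hF.comp_mem 0 (fun _ => r) contDiff_const Fin.elim0 (fun i => i.elim0)
    exact h

/-- The differential structure on the set `N` generated by a set `A` of functions, i.e. the
smallest one containing `A`: the intersection of all differential structures on `N` that
contain `A`, each taken with its own initial topology. -/
def generated {N : Type*} (A : Set (N → ℝ)) : Set (N → ℝ) :=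
  {f | ∀ G : Set (N → ℝ), @IsDifferentialStructure N (initialTopology G) G → A ⊆ G → f ∈ G}

/-- The subspace differential structure on a subset `N` of `(M, F)`, generated by the
restrictions to `N` of the functions in `F`. -/
def subspaceStructure {M : Type*} (F : Set (M → ℝ)) (N : Set M) : Set (N → ℝ) :=
  generated {g | ∃ f ∈ F, g = fun x : N => f x}

/-- A smooth map of differential spaces. -/
def IsSmoothMap {M N : Type*} (F : Set (M → ℝ)) (G : Set (N → ℝ)) (φ : M → N) : Prop :=
  ∀ f ∈ G, f ∘ φ ∈ F

/-- A diffeomorphism of differential spaces. -/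
def IsDiffeo {M N : Type*} (F : Set (M → ℝ)) (G : Set (N → ℝ)) (φ : M → N) : Prop :=
  IsSmoothMap F G φ ∧
    ∃ ψ : N → M, Function.LeftInverse ψ φ ∧ Function.RightInverse ψ φ ∧ IsSmoothMap G F ψ

/-- An embedding of differential spaces: a smooth injective map that is a diffeomorphism onto
its image with the subspace differential structure. -/
def IsEmbedding {M N : Type*} (F : Set (M → ℝ)) (G : Set (N → ℝ)) (φ : M → N) : Prop :=
  IsSmoothMap F G φ ∧ Function.Injective φ ∧
    IsDiffeo F (subspaceStructure G (Set.range φ)) (Set.rangeFactorization φ)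

/-- The standard differential structure of a (finite dimensional) normed space. -/
def smoothFunctions (E : Type*) [NormedAddCommGroup E] [NormedSpace ℝ E] : Set (E → ℝ) :=
  {g | ContDiff ℝ ∞ g}

/-- Some open neighbourhood of `p`, with the subspace differential structure, embeds in `ℝⁿ`. -/
def EmbedsNear {M : Type*} [TopologicalSpace M] (F : Set (M → ℝ)) (p : M) (n : ℕ) : Prop :=
  ∃ U : Set M, IsOpen U ∧ p ∈ U ∧ ∃ φ : U → EuclideanSpace ℝ (Fin n),
    IsEmbedding (subspaceStructure F U) (smoothFunctions (EuclideanSpace ℝ (Fin n))) φ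

/-- A subcartesian space: every point has an open neighbourhood that embeds in some `ℝⁿ`. -/
def IsSubcartesian {M : Type*} [TopologicalSpace M] (F : Set (M → ℝ)) : Prop :=
  ∀ p : M, ∃ n : ℕ, EmbedsNear F p n

/-- The structural dimension at `p`: the smallest `n` such that a neighbourhood of `p` embeds
in `ℝⁿ` (`⊤` if there is none). -/
noncomputable def structuralDimAt {M : Type*} [TopologicalSpace M] (F : Set (M → ℝ)) (p : M) :
    ℕ∞ :=
  ⨅ (n : ℕ) (_ : EmbedsNear F p n), (n : ℕ∞)

/-- The structural dimension: the supremum of the structural dimensions at the points. -/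
noncomputable def structuralDim {M : Type*} [TopologicalSpace M] (F : Set (M → ℝ)) : ℕ∞ :=
  ⨆ p : M, structuralDimAt F p

/-- A map to `M` from an interval (a connected subset of `ℝ`, possibly a single point, not
necessarily open) containing `0`. -/
structure Curve (M : Type*) where
  domain : Set ℝ
  isConnected : IsConnected domain
  zero_mem : (0 : ℝ) ∈ domain
  toFun : domain → M

/-- The starting point `c 0` of a curve. -/
def Curve.start {M : Type*} (c : Curve M) : M := c.toFun ⟨0, c.zero_mem⟩

/-- `g'` is the derivative of `g : J → ℝ`. The values of the extension of `g` outside `J` play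
no role. -/
def IsDerivOn (J : Set ℝ) (g g' : J → ℝ) : Prop :=
  ∀ t : J, HasDerivWithinAt (Function.extend Subtype.val g 0) (g' t) J t

/-- Integral curves of a derivation `v`: any map from a one-point interval, or a smooth map `c`
from an interval with `(f ∘ c)' = v f ∘ c` for every function `f` of the structure. -/
def IsIntegralCurve {M : Type*} [TopologicalSpace M] {F : Set (M → ℝ)}
    {hF : IsDifferentialStructure F} (v : Derivation ℝ hF.subalgebra hF.subalgebra)
    (c : Curve M) : Prop :=
  c.domain = {0} ∨
    (IsSmoothMap (subspaceStructure (smoothFunctions ℝ) c.domain) F c.toFun ∧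
      ∀ f : hF.subalgebra,
        IsDerivOn c.domain ((f : M → ℝ) ∘ c.toFun) ((v f : M → ℝ) ∘ c.toFun))

/-- An integral curve that extends every integral curve with the same starting point. -/
def IsMaximalIntegralCurve {M : Type*} [TopologicalSpace M] {F : Set (M → ℝ)}
    {hF : IsDifferentialStructure F} (v : Derivation ℝ hF.subalgebra hF.subalgebra)
    (c : Curve M) : Prop :=
  IsIntegralCurve v c ∧ ∀ τ : Curve M, IsIntegralCurve v τ → τ.start = c.start →
    ∃ h : τ.domain ⊆ c.domain, ∀ t : τ.domain, c.toFun (Set.inclusion h t) = τ.toFun t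

end DiffSpace

/-! Near a point, an embedding gives coordinates `φ` into `ℝⁿ` through which every function of `F`
is locally smooth. Writing `v φᵢ = Xᵢ ∘ φ` locally turns `v` into a smooth vector field `X` on `ℝⁿ`,
and `φ` carries integral curves to solutions of `u' = X u`. Uniqueness for this ODE and injectivity
of `φ` make integral curves locally unique (`HasVelocityOn.eventuallyEq`); since `M` is Hausdorff,
connectedness makes them globally unique (`HasVelocityOn.eqOn`). A solution of the ODE may leave the
image of `φ` at once, so domains need not be open, and endpoints need care. The derivative condition
alone implies smoothness, even there, because the solution in `ℝⁿ` continues past the endpoint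
(`HasVelocityOn.exists_contDiff`). Hence the union of all integral curves from `p`, the constant one
on `{0}` included, is an integral curve as soon as it has the right derivative, which can be checked
on each side of a point separately. -/

open Set Filter Topology

namespace DiffSpace

/-! ### Subspace structures and local coordinates -/

section Structures

variable {M : Type*}

/-- Functions in a subspace structure are locally restrictions of functions of the ambient
structure. -/
theorem eventually_eq_of_mem_subspaceStructure [TopologicalSpace M] {F : Set (M → ℝ)}
    (hne : F.Nonempty) (hcont : ∀ f ∈ F, Continuous f)
    (hcomp : ∀ (m : ℕ) (g : (Fin m → ℝ) → ℝ), ContDiff ℝ ∞ g →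
      ∀ f : Fin m → M → ℝ, (∀ i, f i ∈ F) → (fun x => g (fun i => f i x)) ∈ F)
    {N : Set M} {g : N → ℝ} (hg : g ∈ subspaceStructure F N) (x : N) :
    ∃ f ∈ F, ∀ᶠ y in 𝓝 (x : M), ∀ h : y ∈ N, g ⟨y, h⟩ = f y := by
  -- By minimality of the generated structure, it suffices that the functions with local extensions
  -- form a differential structure.
  set G : Set (N → ℝ) :=
    {g | ∀ x : N, ∃ f ∈ F, ∀ᶠ y in 𝓝 (x : M), ∀ h : y ∈ N, g ⟨y, h⟩ = f y} with hG
  have hGcont : ∀ g ∈ G, Continuous g := by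
    intro g hg
    rw [continuous_iff_continuousAt]
    intro x
    obtain ⟨f, hf, hfg⟩ := hg x
    have hfx : ContinuousAt (fun y : N => f y) x :=
      ((hcont f hf).comp continuous_subtype_val).continuousAt
    refine hfx.congr ?_
    filter_upwards [continuous_subtype_val.continuousAt.eventually hfg] with y hy
    exact (hy y.2).symm
  -- Locality of `G` is tested in its own initial topology; its neighbourhoods are also
  -- neighbourhoods in the subspace topology.
  have hle : instTopologicalSpaceSubtype ≤ initialTopology G :=
    le_iInf₂ fun g hg => (hGcont g hg).le_induced
  have key : @IsDifferentialStructure N (initialTopology G) G := by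
    let _ : TopologicalSpace N := initialTopology G
    refine ⟨?_, rfl, ?_, ?_⟩
    · obtain ⟨f, hf⟩ := hne
      exact ⟨fun x => f x, fun x => ⟨f, hf, Eventually.of_forall fun y h => rfl⟩⟩
    · intro m g hg f hf x
      choose a haF ha using fun i => hf i x
      refine ⟨_, hcomp m g hg a haF, ?_⟩
      filter_upwards [eventually_all.2 ha] with y hy h
      simp only [hy _ h]
    · intro g hg x
      obtain ⟨U, hU, a, ha, hga⟩ := hg x
      obtain ⟨f, hf, hfa⟩ := ha x
      refine ⟨f, hf, ?_⟩
      have hU' : U ∈ @nhds N instTopologicalSpaceSubtype x := nhds_mono hle hU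
      rw [mem_nhds_subtype] at hU'
      obtain ⟨V, hV, hVU⟩ := hU'
      filter_upwards [hV, hfa] with y hyV hy h
      rw [hga (hVU (show (⟨y, h⟩ : N) ∈ Subtype.val ⁻¹' V from hyV)), hy h]
  refine hg G key ?_ x
  rintro _ ⟨f, hf, rfl⟩ x
  exact ⟨f, hf, Eventually.of_forall fun y h => rfl⟩

/-- Restrictions belong to the subspace structure. -/
theorem restrict_mem_subspaceStructure {F : Set (M → ℝ)} {f : M → ℝ} (hf : f ∈ F) (N : Set M) :
    (fun x : N => f x) ∈ subspaceStructure F N :=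
  fun _ _ hA => hA ⟨f, hf, rfl⟩

theorem IsDifferentialStructure.continuous [TopologicalSpace M] {F : Set (M → ℝ)}
    (hF : IsDifferentialStructure F) {f : M → ℝ} (hf : f ∈ F) : Continuous f := by
  rw [continuous_iff_le_induced]
  exact hF.topology_eq.le.trans (iInf₂_le f hf)

theorem IsDifferentialStructure.nhds_eq [TopologicalSpace M] {F : Set (M → ℝ)}
    (hF : IsDifferentialStructure F) (p : M) : 𝓝 p = ⨅ f ∈ F, comap f (𝓝 (f p)) := by
  have h : 𝓝 p = @nhds M (initialTopology F) p := by rw [← hF.topology_eq]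
  simp only [h, nhds_iInf, nhds_induced]

theorem IsDifferentialStructure.eventually_eq_of_mem_subspace [TopologicalSpace M]
    {F : Set (M → ℝ)} (hF : IsDifferentialStructure F) {N : Set M} {g : N → ℝ}
    (hg : g ∈ subspaceStructure F N) (x : N) :
    ∃ f ∈ F, ∀ᶠ y in 𝓝 (x : M), ∀ h : y ∈ N, g ⟨y, h⟩ = f y :=
  eventually_eq_of_mem_subspaceStructure hF.nonempty (fun _ => hF.continuous) hF.comp_mem hg x

/-- Functions in the structure of a subset of a normed space are locally restrictions of smooth
functions. -/
theorem eventually_eq_contDiff_of_mem_subspace {E : Type*} [NormedAddCommGroup E]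
    [NormedSpace ℝ E] {N : Set E} {g : N → ℝ}
    (hg : g ∈ subspaceStructure (smoothFunctions E) N) (x : N) :
    ∃ f : E → ℝ, ContDiff ℝ ∞ f ∧ ∀ᶠ y in 𝓝 (x : E), ∀ h : y ∈ N, g ⟨y, h⟩ = f y := by
  refine eventually_eq_of_mem_subspaceStructure (F := smoothFunctions E)
    ⟨fun _ => 0, contDiff_const (𝕜 := ℝ) (n := ∞)⟩
    (fun f hf => ContDiff.continuous (n := ∞) hf) ?_ hg x
  intro m g hg f hf
  exact ContDiff.comp (n := ∞) hg (contDiff_pi.2 hf)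

/-- A function on a subset of `ℝ` that is locally a restriction of smooth functions belongs to the
subspace structure. -/
theorem mem_subspaceStructure_real {J : Set ℝ} {g : J → ℝ}
    (hg : ∀ x : J, ∃ f : ℝ → ℝ, ContDiff ℝ ∞ f ∧ ∀ᶠ y in 𝓝 (x : ℝ), ∀ h : y ∈ J, g ⟨y, h⟩ = f y) :
    g ∈ subspaceStructure (smoothFunctions ℝ) J := by
  intro G hG hsub
  let _ : TopologicalSpace J := initialTopology G
  -- The restriction of `id` lies in `G`, so neighbourhoods in `ℝ` pull back to neighbourhoods in
  -- the initial topology of `G`.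
  have hval : Continuous (Subtype.val : J → ℝ) :=
    hG.continuous (hsub ⟨id, contDiff_id (𝕜 := ℝ) (n := ∞), rfl⟩)
  refine hG.mem_of_locally g fun x => ?_
  obtain ⟨f, hf, hfg⟩ := hg x
  exact ⟨_, hval.continuousAt.eventually hfg, _, hsub ⟨f, hf, rfl⟩, fun y hy => hy y.2⟩

/-- Local coordinates of a subcartesian space, as globally defined functions. -/
theorem EmbedsNear.exists_coordinates [TopologicalSpace M] {F : Set (M → ℝ)}
    (hF : IsDifferentialStructure F) {p : M} {n : ℕ} (h : EmbedsNear F p n) :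
    ∃ φ : Fin n → M → ℝ, (∀ i, φ i ∈ F) ∧ (∃ W ∈ 𝓝 p, InjOn (fun x i => φ i x) W) ∧
      ∀ f ∈ F, ∃ g : (Fin n → ℝ) → ℝ, ContDiff ℝ ∞ g ∧ ∀ᶠ x in 𝓝 p, f x = g (fun i => φ i x) := by
  obtain ⟨U, hU, hpU, Φ, hΦ, hinj, -, ψ, hψ, -, hψs⟩ := h
  have hcoord : ∀ i, (fun x => Φ x i) ∈ subspaceStructure F U := fun i =>
    hΦ (fun y => y i) (show ContDiff ℝ ∞ _ by fun_prop)
  choose φ hφF hφ using fun i => hF.eventually_eq_of_mem_subspace (hcoord i) ⟨p, hpU⟩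
  have hev : ∀ᶠ x in 𝓝 p, ∃ hx : x ∈ U, Φ ⟨x, hx⟩ = WithLp.toLp 2 (fun i => φ i x) := by
    filter_upwards [hU.mem_nhds hpU, eventually_all.2 hφ] with x hx hφx
    refine ⟨hx, ?_⟩
    ext i
    exact hφx i hx
  refine ⟨φ, hφF, ⟨_, hev, ?_⟩, fun f hf => ?_⟩
  · rintro x ⟨hx, hx'⟩ y ⟨hy, hy'⟩ hxy
    have : Φ ⟨x, hx⟩ = Φ ⟨y, hy⟩ := by
      rw [hx', hy']
      exact congrArg _ hxy
    exact congrArg Subtype.val (hinj this)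
  · obtain ⟨g, hg, hfg⟩ := eventually_eq_contDiff_of_mem_subspace
      (hψs _ (restrict_mem_subspaceStructure hf U)) (rangeFactorization Φ ⟨p, hpU⟩)
    refine ⟨fun y => g (WithLp.toLp 2 y), hg.comp (PiLp.contDiff_toLp), ?_⟩
    have hcont : ContinuousAt (fun x => WithLp.toLp 2 (fun i => φ i x)) p :=
      ((PiLp.continuous_toLp 2 _).comp
        (continuous_pi fun i => hF.continuous (hφF i))).continuousAt
    have hp : WithLp.toLp 2 (fun i => φ i p) = Φ ⟨p, hpU⟩ := (hev.self_of_nhds.2).symm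
    have hfg' : ∀ᶠ y in 𝓝 (WithLp.toLp 2 (fun i => φ i p)), ∀ h : y ∈ range Φ,
        f (ψ ⟨y, h⟩) = g y := by
      rw [hp]; exact hfg
    filter_upwards [hcont.eventually hfg', hev] with x hx ⟨hxU, hx'⟩
    rw [← hx'] at hx
    rw [← hx', ← hx (mem_range_self _)]
    exact congrArg (fun z : U => f z) (hψ ⟨x, hxU⟩).symm

/-- A subcartesian space is Hausdorff. -/
theorem IsSubcartesian.t2Space [TopologicalSpace M] {F : Set (M → ℝ)}
    (hF : IsDifferentialStructure F) (hsub : IsSubcartesian F) : T2Space M := by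
  refine ⟨fun x y hxy => ?_⟩
  suffices ∃ f ∈ F, f x ≠ f y by
    obtain ⟨f, hf, hne⟩ := this
    exact separated_by_continuous (hF.continuous hf) hne
  by_contra! hcon
  obtain ⟨n, hn⟩ := hsub x
  obtain ⟨φ, hφF, ⟨W, hW, hinj⟩, -⟩ := hn.exists_coordinates hF
  -- In an initial topology, points not separated by functions have the same neighbourhoods, so `y`
  -- would lie in a chart around `x`, where the coordinates separate points.
  have hnhds : 𝓝 x = 𝓝 y := by
    rw [hF.nhds_eq, hF.nhds_eq]
    exact iInf_congr fun f => iInf_congr fun hf => by rw [hcon f hf]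
  exact hxy (hinj (mem_of_mem_nhds hW) (mem_of_mem_nhds (hnhds ▸ hW))
    (funext fun i => hcon _ (hφF i)))

end Structures

/-! ### Ordinary differential equations in normed spaces -/

section ODE

variable {E : Type*} [NormedAddCommGroup E] [NormedSpace ℝ E]

/-- Local uniqueness of solutions of an autonomous ODE on an interval, which may have `t₀` as an
endpoint. -/
theorem eventuallyEq_nhdsWithin_of_hasDerivWithinAt {X : E → E} {u w : ℝ → E} {S : Set ℝ} {t₀ : ℝ}
    (hS : S.OrdConnected) (ht₀ : t₀ ∈ S) (hX : ContDiffAt ℝ 1 X (u t₀))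
    (hu : ∀ᶠ t in 𝓝[S] t₀, HasDerivWithinAt u (X (u t)) S t)
    (hw : ∀ᶠ t in 𝓝[S] t₀, HasDerivWithinAt w (X (w t)) S t) (heq : u t₀ = w t₀) :
    u =ᶠ[𝓝[S] t₀] w := by
  obtain ⟨K, s, hs, hK⟩ := hX.exists_lipschitzOnWith
  have hus := (hu.self_of_nhdsWithin ht₀).continuousWithinAt.eventually hs
  have hws := (hw.self_of_nhdsWithin ht₀).continuousWithinAt.eventually (heq ▸ hs)
  obtain ⟨δ, hδ, h⟩ := Metric.mem_nhdsWithin_iff.1 ((hu.and hw).and (hus.and hws))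
  refine Metric.mem_nhdsWithin_iff.2 ⟨δ, hδ, fun t ⟨htδ, htS⟩ => ?_⟩
  have hball : ∀ {a}, a ∈ uIcc t₀ t → a ∈ Metric.ball t₀ δ ∩ S := fun ha =>
    ⟨(convex_ball t₀ δ).ordConnected.uIcc_subset (Metric.mem_ball_self hδ) htδ ha,
      hS.uIcc_subset ht₀ htS ha⟩
  -- Each side of `t₀` is treated alone, since `S` may lie on one side only; Grönwall uniqueness
  -- needs just one-sided derivatives.
  rcases le_total t₀ t with hle | hle
  · rw [uIcc_of_le hle] at hball
    have hI : Icc t₀ t ⊆ S := fun a ha => (hball ha).2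
    have hmono : ∀ a ∈ Ico t₀ t, 𝓝[Ici a] a ≤ 𝓝[S] a := fun a ha =>
      nhdsWithin_le_of_mem (mem_of_superset (Icc_mem_nhdsGE ha.2) fun b hb =>
        hI ⟨ha.1.trans hb.1, hb.2⟩)
    exact ODE_solution_unique_of_mem_Icc_right (v := fun _ => X) (s := fun _ => s) (K := K)
      (fun _ _ => hK)
      (fun a ha => (h (hball ha)).1.1.continuousWithinAt.mono hI)
      (fun a ha => (h (hball (Ico_subset_Icc_self ha))).1.1.mono_of_mem_nhdsWithin
        (hmono a ha self_mem_nhdsWithin))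
      (fun a ha => (h (hball (Ico_subset_Icc_self ha))).2.1)
      (fun a ha => (h (hball ha)).1.2.continuousWithinAt.mono hI)
      (fun a ha => (h (hball (Ico_subset_Icc_self ha))).1.2.mono_of_mem_nhdsWithin
        (hmono a ha self_mem_nhdsWithin))
      (fun a ha => (h (hball (Ico_subset_Icc_self ha))).2.2) heq ⟨hle, le_rfl⟩
  · rw [uIcc_of_ge hle] at hball
    have hI : Icc t t₀ ⊆ S := fun a ha => (hball ha).2
    have hmono : ∀ a ∈ Ioc t t₀, 𝓝[Iic a] a ≤ 𝓝[S] a := fun a ha =>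
      nhdsWithin_le_of_mem (mem_of_superset (Icc_mem_nhdsLE ha.1) fun b hb =>
        hI ⟨hb.1, hb.2.trans ha.2⟩)
    exact ODE_solution_unique_of_mem_Icc_left (v := fun _ => X) (s := fun _ => s) (K := K)
      (fun _ _ => hK)
      (fun a ha => (h (hball ha)).1.1.continuousWithinAt.mono hI)
      (fun a ha => (h (hball (Ioc_subset_Icc_self ha))).1.1.mono_of_mem_nhdsWithin
        (hmono a ha self_mem_nhdsWithin))
      (fun a ha => (h (hball (Ioc_subset_Icc_self ha))).2.1)
      (fun a ha => (h (hball ha)).1.2.continuousWithinAt.mono hI)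
      (fun a ha => (h (hball (Ioc_subset_Icc_self ha))).1.2.mono_of_mem_nhdsWithin
        (hmono a ha self_mem_nhdsWithin))
      (fun a ha => (h (hball (Ioc_subset_Icc_self ha))).2.2) heq ⟨le_rfl, hle⟩

/-- A smooth autonomous ODE has a smooth solution near any initial time. -/
theorem exists_contDiffAt_solution [CompleteSpace E] {X : E → E} (hX : ContDiff ℝ ∞ X) (t₀ : ℝ)
    (x₀ : E) :
    ∃ α : ℝ → E, α t₀ = x₀ ∧ ∀ᶠ t in 𝓝 t₀, HasDerivAt α (X (α t)) t ∧ ContDiffAt ℝ ∞ α t := by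
  obtain ⟨α, hα, ε, hε, h⟩ :=
    (hX.contDiffAt.of_le
      (by simp)).exists_forall_mem_closedBall_exists_eq_forall_mem_Ioo_hasDerivAt₀ t₀
  have hsub : Icc (t₀ - ε / 2) (t₀ + ε / 2) ⊆ Ioo (t₀ - ε) (t₀ + ε) :=
    Icc_subset_Ioo (by linarith) (by linarith)
  have hsm : ContDiffOn ℝ ∞ α (Icc (t₀ - ε / 2) (t₀ + ε / 2)) :=
    ODE.contDiffOn_enat_Icc_of_hasDerivWithinAt (n := ⊤) (f := fun _ => X) (u := univ)
      (hX.comp contDiff_snd).contDiffOn (fun t ht => (h t (hsub ht)).hasDerivWithinAt)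
      (mapsTo_univ _ _)
  refine ⟨α, hα, ?_⟩
  filter_upwards [Ioo_mem_nhds (show t₀ - ε / 2 < t₀ by linarith)
    (show t₀ < t₀ + ε / 2 by linarith)] with t ht
  exact ⟨h t (hsub (Ioo_subset_Icc_self ht)), hsm.contDiffAt (Icc_mem_nhds ht.1 ht.2)⟩

/-- The germ of a smooth function extends to a globally smooth function. -/
theorem exists_contDiff_eventuallyEq {g : ℝ → ℝ} {t₀ : ℝ}
    (hg : ∀ᶠ t in 𝓝 t₀, ContDiffAt ℝ ∞ g t) : ∃ h : ℝ → ℝ, ContDiff ℝ ∞ h ∧ g =ᶠ[𝓝 t₀] h := by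
  obtain ⟨ε, hε, hball⟩ := Metric.eventually_nhds_iff_ball.1 hg
  let b : ContDiffBump t₀ := ⟨ε / 4, ε / 2, by positivity, by linarith⟩
  refine ⟨fun t => b t * g t, contDiff_iff_contDiffAt.2 fun t => ?_, ?_⟩
  · by_cases ht : t ∈ Metric.ball t₀ ε
    · exact b.contDiffAt.mul (hball t ht)
    · have ht' : t ∉ tsupport b := by
        rw [b.tsupport_eq]
        intro h
        exact ht (Metric.closedBall_subset_ball (show ε / 2 < ε by linarith) h)
      refine (contDiffAt_const (c := (0 : ℝ))).congr_of_eventuallyEq ?_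
      filter_upwards [notMem_tsupport_iff_eventuallyEq.1 ht'] with s hs
      simp [hs]
  · filter_upwards [b.eventuallyEq_one] with t ht
    simp [ht]

end ODE

/-! ### Integral curves of derivations -/

section IntegralCurves

/-- The extension of a curve to `ℝ` by its starting point. -/
noncomputable def Curve.extension {M : Type*} (c : Curve M) : ℝ → M :=
  Function.extend Subtype.val c.toFun fun _ => c.start

theorem Curve.extension_apply {M : Type*} (c : Curve M) {t : ℝ} (ht : t ∈ c.domain) :
    c.extension t = c.toFun ⟨t, ht⟩ :=
  Subtype.val_injective.extend_apply c.toFun _ (⟨t, ht⟩ : c.domain)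

theorem Curve.ordConnected {M : Type*} (c : Curve M) : c.domain.OrdConnected :=
  c.isConnected.isPreconnected.ordConnected

variable {M : Type*} [TopologicalSpace M] {F : Set (M → ℝ)} {hF : IsDifferentialStructure F}

/-- The derivative condition for integral curves on a set of times, for a map defined on `ℝ`. -/
def HasVelocityOn (v : Derivation ℝ hF.subalgebra hF.subalgebra) (γ : ℝ → M) (J : Set ℝ) : Prop :=
  ∀ f : hF.subalgebra, ∀ t ∈ J,
    HasDerivWithinAt (fun s => (f : M → ℝ) (γ s)) ((v f : M → ℝ) (γ t)) J t

variable {v : Derivation ℝ hF.subalgebra hF.subalgebra} {γ τ : ℝ → M} {J K : Set ℝ}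

theorem HasVelocityOn.mono (h : HasVelocityOn v γ J) (hK : K ⊆ J) : HasVelocityOn v γ K :=
  fun f t ht => (h f t (hK ht)).mono hK

/-- The topology is initial for `F`, and each `f ∘ γ` is differentiable within `J`, hence continuous
there. -/
theorem HasVelocityOn.continuousOn (h : HasVelocityOn v γ J) : ContinuousOn γ J := by
  intro t ht
  rw [ContinuousWithinAt, hF.nhds_eq, tendsto_iInf]
  intro f
  rw [tendsto_iInf]
  intro hf
  exact tendsto_comap_iff.2 (h ⟨f, hf⟩ t ht).continuousWithinAt

/-- In local coordinates a derivation is a smooth vector field. -/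
theorem exists_coordinates_vectorField (hsub : IsSubcartesian F)
    (v : Derivation ℝ hF.subalgebra hF.subalgebra) (p : M) :
    ∃ (n : ℕ) (φ : M → Fin n → ℝ) (X : (Fin n → ℝ) → Fin n → ℝ), ContDiff ℝ ∞ X ∧
      (∃ W ∈ 𝓝 p, InjOn φ W) ∧
      (∀ f ∈ F, ∃ g : (Fin n → ℝ) → ℝ, ContDiff ℝ ∞ g ∧ ∀ᶠ x in 𝓝 p, f x = g (φ x)) ∧
      ∀ (γ : ℝ → M) (J : Set ℝ), HasVelocityOn v γ J → ∀ t₀ ∈ J, γ t₀ = p →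
        ∀ᶠ t in 𝓝[J] t₀, HasDerivWithinAt (φ ∘ γ) (X (φ (γ t))) J t := by
  obtain ⟨n, hn⟩ := hsub p
  obtain ⟨φ, hφF, hinj, hloc⟩ := hn.exists_coordinates hF
  -- `X` is a choice: only its values on the image of `φ` near `φ p` are determined by `v`.
  choose X hX hXφ using fun i => hloc (v ⟨φ i, hφF i⟩ : M → ℝ) (v ⟨φ i, hφF i⟩).2
  refine ⟨n, fun x i => φ i x, fun y i => X i y, contDiff_pi.2 hX, hinj, hloc, ?_⟩
  rintro γ J hγ t₀ ht₀ rfl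
  filter_upwards [(hγ.continuousOn t₀ ht₀).eventually (eventually_all.2 hXφ),
    self_mem_nhdsWithin] with t ht htJ
  refine hasDerivWithinAt_pi.2 fun i => ?_
  rw [← ht i]
  exact hγ ⟨φ i, hφF i⟩ t htJ

theorem HasVelocityOn.eventuallyEq (hsub : IsSubcartesian F) (hγ : HasVelocityOn v γ J)
    (hτ : HasVelocityOn v τ J) (hJ : J.OrdConnected) {t₀ : ℝ} (ht₀ : t₀ ∈ J)
    (h : γ t₀ = τ t₀) : γ =ᶠ[𝓝[J] t₀] τ := by
  obtain ⟨n, φ, X, hX, ⟨W, hW, hinj⟩, -, hvel⟩ := exists_coordinates_vectorField hsub v (γ t₀)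
  have := eventuallyEq_nhdsWithin_of_hasDerivWithinAt hJ ht₀ (hX.contDiffAt.of_le (by simp))
    (hvel γ J hγ t₀ ht₀ rfl) (hvel τ J hτ t₀ ht₀ h.symm) (congrArg φ h)
  filter_upwards [this, (hγ.continuousOn t₀ ht₀).eventually hW,
    (hτ.continuousOn t₀ ht₀).eventually (h ▸ hW)] with t h₁ h₂ h₃
  exact hinj h₂ h₃ h₁

theorem HasVelocityOn.eqOn (hsub : IsSubcartesian F) (hγ : HasVelocityOn v γ J)
    (hτ : HasVelocityOn v τ J) (hJ : J.OrdConnected) {t₀ : ℝ} (ht₀ : t₀ ∈ J)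
    (h : γ t₀ = τ t₀) : EqOn γ τ J := by
  have := hsub.t2Space hF
  have : PreconnectedSpace J := isPreconnected_iff_preconnectedSpace.1 hJ.isPreconnected
  have hclosed : IsClosed {t : J | γ t = τ t} :=
    isClosed_eq hγ.continuousOn.domRestrict hτ.continuousOn.domRestrict
  have hopen : IsOpen {t : J | γ t = τ t} := by
    refine isOpen_iff_mem_nhds.2 fun t ht => ?_
    exact eventually_nhds_subtype_iff J t (fun s => γ s = τ s) |>.2
      (hγ.eventuallyEq hsub hτ hJ t.2 ht)
  have huniv := IsClopen.eq_univ ⟨hclosed, hopen⟩ ⟨⟨t₀, ht₀⟩, h⟩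
  exact fun t ht => huniv.ge (mem_univ (⟨t, ht⟩ : J))

/-- Curves with the right derivative are locally restrictions of smooth curves, even at
endpoints. -/
theorem HasVelocityOn.exists_contDiff (hsub : IsSubcartesian F) (hγ : HasVelocityOn v γ J)
    (hJ : J.OrdConnected) {t₀ : ℝ} (ht₀ : t₀ ∈ J) {f : M → ℝ} (hf : f ∈ F) :
    ∃ h : ℝ → ℝ, ContDiff ℝ ∞ h ∧ ∀ᶠ t in 𝓝[J] t₀, f (γ t) = h t := by
  obtain ⟨n, φ, X, hX, -, hloc, hvel⟩ := exists_coordinates_vectorField hsub v (γ t₀)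
  obtain ⟨α, hα₀, hα⟩ := exists_contDiffAt_solution hX t₀ (φ (γ t₀))
  obtain ⟨g, hg, hfg⟩ := hloc f hf
  obtain ⟨h, hh, hgh⟩ := exists_contDiff_eventuallyEq (g := g ∘ α) (t₀ := t₀)
    (hα.mono fun t ht => hg.contDiffAt.comp t ht.2)
  have := eventuallyEq_nhdsWithin_of_hasDerivWithinAt hJ ht₀ (hX.contDiffAt.of_le (by simp))
    (hvel γ J hγ t₀ ht₀ rfl)
    (nhdsWithin_le_nhds (hα.mono fun t ht => ht.1.hasDerivWithinAt)) hα₀.symm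
  refine ⟨h, hh, ?_⟩
  filter_upwards [this, (hγ.continuousOn t₀ ht₀).eventually hfg, nhdsWithin_le_nhds hgh]
    with t h₁ h₂ h₃
  rw [h₂, ← h₃, Function.comp_apply, ← h₁, Function.comp_apply]

/-- Smoothness is automatic from the ODE, and on `{0}` the derivative condition is vacuous, so both
cases of the definition merge into one. -/
theorem isIntegralCurve_iff_hasVelocityOn (hsub : IsSubcartesian F) (c : Curve M) :
    IsIntegralCurve v c ↔ HasVelocityOn v c.extension c.domain := by
  have hderiv : (∀ f : hF.subalgebra,
      IsDerivOn c.domain ((f : M → ℝ) ∘ c.toFun) ((v f : M → ℝ) ∘ c.toFun)) ↔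
      HasVelocityOn v c.extension c.domain := by
    refine forall_congr' fun f => Subtype.forall.trans (forall₂_congr fun t ht => ?_)
    have heq : ∀ s ∈ c.domain, Function.extend Subtype.val ((f : M → ℝ) ∘ c.toFun) 0 s =
        (f : M → ℝ) (c.extension s) := fun s hs => by
      rw [c.extension_apply hs]
      exact Subtype.val_injective.extend_apply _ _ (⟨s, hs⟩ : c.domain)
    rw [c.extension_apply ht]
    exact ⟨fun h => h.congr (fun s hs => (heq s hs).symm) (heq t ht).symm,
      fun h => h.congr heq (heq t ht)⟩
  constructor
  · rintro (h | h)
    · intro f t ht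
      rw [h]
      exact HasFDerivWithinAt.of_subsingleton subsingleton_singleton
    · exact hderiv.1 h.2
  · intro h
    refine Or.inr ⟨fun f hf => mem_subspaceStructure_real fun t => ?_, hderiv.2 h⟩
    obtain ⟨g, hg, hfg⟩ := h.exists_contDiff hsub c.ordConnected t.2 hf
    refine ⟨g, hg, (eventually_nhdsWithin_iff.1 hfg).mono fun s hs hsJ => ?_⟩
    rw [← hs hsJ, c.extension_apply hsJ]
    rfl

/-- The integral curve from `p` that is the union of all of them. -/
theorem exists_isMaximalIntegralCurve (hsub : IsSubcartesian F)
    (v : Derivation ℝ hF.subalgebra hF.subalgebra) (p : M) :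
    ∃ c : Curve M, IsMaximalIntegralCurve v c ∧ c.start = p := by
  let C : Set (Curve M) := {c | IsIntegralCurve v c ∧ c.start = p}
  have hC : ∀ c ∈ C, HasVelocityOn v c.extension c.domain := fun c hc =>
    (isIntegralCurve_iff_hasVelocityOn hsub c).1 hc.1
  have h0 : ∀ c ∈ C, c.extension 0 = p := fun c hc => (c.extension_apply c.zero_mem).trans hc.2
  let trivialCurve : Curve M := ⟨{0}, isConnected_singleton, rfl, fun _ => p⟩
  have htriv : trivialCurve ∈ C := ⟨Or.inl rfl, rfl⟩
  have hagree : ∀ c ∈ C, ∀ c' ∈ C, EqOn c.extension c'.extension (c.domain ∩ c'.domain) :=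
    fun c hc c' hc' => ((hC c hc).mono inter_subset_left).eqOn hsub
      ((hC c' hc').mono inter_subset_right) (c.ordConnected.inter c'.ordConnected)
      ⟨c.zero_mem, c'.zero_mem⟩ ((h0 c hc).trans (h0 c' hc').symm)
  let D : Set ℝ := ⋃ c ∈ C, c.domain
  have hD : ∀ t : D, ∃ c ∈ C, (t : ℝ) ∈ c.domain := fun t => by
    simpa only [D, mem_iUnion₂, exists_prop] using t.2
  choose wit hwit hmem using hD
  have hsubD : ∀ c ∈ C, c.domain ⊆ D := fun c hc => subset_biUnion_of_mem hc
  have hzero : (0 : ℝ) ∈ D := hsubD _ htriv rfl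
  have hconn : IsConnected D :=
    ⟨⟨0, hzero⟩, isPreconnected_of_forall 0 fun t ht => ⟨_, hsubD _ (hwit ⟨t, ht⟩),
      (wit ⟨t, ht⟩).zero_mem, hmem ⟨t, ht⟩, (wit ⟨t, ht⟩).isConnected.isPreconnected⟩⟩
  let m : Curve M := ⟨D, hconn, hzero, fun t => (wit t).extension t⟩
  have hm : ∀ c ∈ C, EqOn m.extension c.extension c.domain := fun c hc t ht => by
    rw [m.extension_apply (hsubD c hc ht)]
    exact hagree _ (hwit _) c hc ⟨hmem _, ht⟩
  have hmstart : m.start = p := by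
    rw [← h0 _ htriv, ← hm _ htriv rfl]
    exact (m.extension_apply hzero).symm
  -- No single curve need cover a neighbourhood of `t` in `D`: at `0`, one may go only left and
  -- another only right. One suffices on each side.
  have hright : ∀ t ∈ D, ∃ c ∈ C, t ∈ c.domain ∧ c.domain ∈ 𝓝[D ∩ Ici t] t := by
    intro t ht
    by_cases hlast : ∃ s ∈ D, t < s
    · obtain ⟨s, hs, hts⟩ := hlast
      obtain ⟨c, hc, s', hts', hs'⟩ : ∃ c ∈ C, ∃ s', t < s' ∧ Icc t s' ⊆ c.domain := by
        -- All domains contain `0`: a curve reaching `s` covers `[t, s]` if `t ≥ 0`, and one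
        -- reaching `t` covers `[t, 0]` otherwise.
        rcases le_or_gt 0 t with h | h
        · exact ⟨_, hwit ⟨s, hs⟩, s, hts, (Icc_subset_Icc_left h).trans
            ((wit ⟨s, hs⟩).ordConnected.out (wit _).zero_mem (hmem ⟨s, hs⟩))⟩
        · exact ⟨_, hwit ⟨t, ht⟩, 0, h,
            (wit ⟨t, ht⟩).ordConnected.out (hmem ⟨t, ht⟩) (wit _).zero_mem⟩
      exact ⟨c, hc, hs' ⟨le_rfl, hts'.le⟩,
        nhdsWithin_mono _ inter_subset_right (mem_of_superset (Icc_mem_nhdsGE hts') hs')⟩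
    · push Not at hlast
      refine ⟨_, hwit ⟨t, ht⟩, hmem ⟨t, ht⟩, mem_of_superset self_mem_nhdsWithin ?_⟩
      rintro s ⟨hsD, hs⟩
      rw [le_antisymm (hlast s hsD) hs]
      exact hmem ⟨t, ht⟩
  have hleft : ∀ t ∈ D, ∃ c ∈ C, t ∈ c.domain ∧ c.domain ∈ 𝓝[D ∩ Iic t] t := by
    intro t ht
    by_cases hfirst : ∃ s ∈ D, s < t
    · obtain ⟨s, hs, hts⟩ := hfirst
      obtain ⟨c, hc, s', hts', hs'⟩ : ∃ c ∈ C, ∃ s', s' < t ∧ Icc s' t ⊆ c.domain := by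
        rcases le_or_gt t 0 with h | h
        · exact ⟨_, hwit ⟨s, hs⟩, s, hts, (Icc_subset_Icc_right h).trans
            ((wit ⟨s, hs⟩).ordConnected.out (hmem ⟨s, hs⟩) (wit _).zero_mem)⟩
        · exact ⟨_, hwit ⟨t, ht⟩, 0, h,
            (wit ⟨t, ht⟩).ordConnected.out (wit _).zero_mem (hmem ⟨t, ht⟩)⟩
      exact ⟨c, hc, hs' ⟨hts'.le, le_rfl⟩,
        nhdsWithin_mono _ inter_subset_right (mem_of_superset (Icc_mem_nhdsLE hts') hs')⟩
    · push Not at hfirst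
      refine ⟨_, hwit ⟨t, ht⟩, hmem ⟨t, ht⟩, mem_of_superset self_mem_nhdsWithin ?_⟩
      rintro s ⟨hsD, hs⟩
      rw [le_antisymm hs (hfirst s hsD)]
      exact hmem ⟨t, ht⟩
  have hside : ∀ (f : hF.subalgebra) (A : Set ℝ) (t : ℝ),
      (∃ c ∈ C, t ∈ c.domain ∧ c.domain ∈ 𝓝[A] t) →
      HasDerivWithinAt (fun s => (f : M → ℝ) (m.extension s)) ((v f : M → ℝ) (m.extension t))
        A t := by
    rintro f A t ⟨c, hc, htc, hcA⟩
    have := (hC c hc f t htc).congr (fun s hs => congrArg (f : M → ℝ) (hm c hc hs))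
      (congrArg (f : M → ℝ) (hm c hc htc))
    rw [← hm c hc htc] at this
    exact this.mono_of_mem_nhdsWithin hcA
  have hmv : HasVelocityOn v m.extension m.domain := by
    intro f t ht
    -- The two one-sided derivatives agree, so they glue.
    have := (hside f (D ∩ Ici t) t (hright t ht)).union
      (hside f (D ∩ Iic t) t (hleft t ht))
    rwa [← inter_union_distrib_left, Ici_union_Iic, inter_univ] at this
  refine ⟨m, ⟨(isIntegralCurve_iff_hasVelocityOn hsub m).2 hmv, fun τ hτ hτm => ?_⟩, hmstart⟩
  have hτC : τ ∈ C := ⟨hτ, hτm.trans hmstart⟩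
  refine ⟨hsubD τ hτC, fun t => ?_⟩
  have := hm τ hτC t.2
  rwa [m.extension_apply (hsubD τ hτC t.2), τ.extension_apply t.2] at this

theorem IsMaximalIntegralCurve.unique {c d : Curve M} (hc : IsMaximalIntegralCurve v c)
    (hd : IsMaximalIntegralCurve v d) (h : c.start = d.start) : c = d := by
  obtain ⟨h₁, h₁'⟩ := hc.2 d hd.1 h.symm
  obtain ⟨h₂, -⟩ := hd.2 c hc.1 h
  obtain ⟨J, hJ, hJ0, γ⟩ := c
  obtain ⟨K, hK, hK0, τ⟩ := d
  obtain rfl : J = K := Subset.antisymm h₂ h₁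
  congr 1
  exact funext h₁'

end IntegralCurves

end DiffSpace

theorem corollary3p17 {M : Type*} [TopologicalSpace M] [SecondCountableTopology M]
    {F : Set (M → ℝ)} (hF : DiffSpace.IsDifferentialStructure F)
    (hsub : DiffSpace.IsSubcartesian F) (hdim : DiffSpace.structuralDim F < ⊤)
    (v : Derivation ℝ hF.subalgebra hF.subalgebra) (p : M) :
    ∃! c : DiffSpace.Curve M, DiffSpace.IsMaximalIntegralCurve v c ∧ c.start = p := by
  obtain ⟨c, hc, hcp⟩ := DiffSpace.exists_isMaximalIntegralCurve hsub v p
  exact ⟨c, ⟨hc, hcp⟩, fun d hd => hd.1.unique hc (hd.2.trans hcp.symm)⟩
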